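/- Let $A$ be a commutative ring with unit, and let $T \subseteq A$ be a subsemiring (a subset containing $0$ and $1$ and closed under addition and multiplication). Assume that $T$ is archimedean, i.e. for every $g \in A$ there is $n \in \mathbb{Z}$ with $n + g \in T$, and that for some integer $n > 1$ the element $n$ is invertible in $A$ and $\frac1n \in T$. Let $\mathrm{Sper}(A)$ be the real spectrum of $A$, i.e. the set of all pairs $\alpha = (\mathfrak{p}, \le)$ where $\mathfrak{p}$ is a prime ideal of $A$ and $\le$ is an ordering of the residue field $\kappa(\mathfrak{p})$ of $\mathfrak{p}$. For $g \in A$ write $g \ge_\alpha 0$ if the image of $g$ in $\kappa(\mathfrak{p})$ is nonnegative with respect to $\le$, and let $X_A(T)$ be the set of all $\alpha \in \mathrm{Sper}(A)$ such that $t \ge_\alpha 0$ for every $t \in T$. We say that $g \ge 0$ on $X_A(T)$ if $g \ge_\alpha 0$ for every $\alpha \in X_A(T)$. Let $f \in A$. Suppose that for every maximal ideal $\mathfrak{m}$ of $A$ there is an element $s \in A \setminus \mathfrak{m}$ such that $s \ge 0$ on $X_A(T)$ and $sf \in T$. Then $f \in T$. -/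

import Mathlib

/-- A point of the real spectrum `Sper A` of a commutative ring `A`: a pair `(𝔭, ≤)` of a prime
ideal `𝔭` of `A` and an ordering `≤` of the residue field of `𝔭` (that is, a total order which
makes this field an ordered field). -/
structure RealSpectrum (A : Type*) [CommRing A] where
  /-- the prime ideal `𝔭` (the support of the point) -/
  support : PrimeSpectrum A
  /-- the total order on the residue field of `𝔭` -/
  order : LinearOrder support.asIdeal.ResidueField
  /-- the order is compatible with the field operations -/
  isStrictOrderedRing : IsStrictOrderedRing support.asIdeal.ResidueField

namespace RealSpectrum

variable {A : Type*} [CommRing A]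

/-- `f ≥ 0` at the point `α = (𝔭, ≤)`: the image of `f` in the residue field of `𝔭` is
nonnegative with respect to `≤`. -/
def NonnegAt (α : RealSpectrum A) (f : A) : Prop :=
  α.order.le 0 (algebraMap A α.support.asIdeal.ResidueField f)

/-- For a subsemiring `T` of `A`, the set `X_A(T)` of all points of `Sper A` at which all
elements of `T` are nonnegative. -/
def nonnegLocus (T : Subsemiring A) : Set (RealSpectrum A) :=
  {α | ∀ t ∈ T, α.NonnegAt t}

end RealSpectrum

/-- A subsemiring `T` of a ring `A` is archimedean if for every `f` in `A` there is an integer `n`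
with `n + f` in `T`. -/
def Subsemiring.IsArchimedean {A : Type*} [CommRing A] (T : Subsemiring A) : Prop :=
  ∀ f : A, ∃ n : ℤ, (n : A) + f ∈ T

/-! The admissible multipliers `s` generate the unit ideal, so `1 = ∑ aᵢ sᵢ`, and `S = ∑ sᵢ` is
positive on `X_A(T)`. Once the `aᵢ` are replaced by `bᵢ ∈ T`, `f = ∑ bᵢ (sᵢ f)` lies in `T`. By
`exists_sub_inv_mem`, `S - 1/m ∈ T` for some `m`. With `q = 1 - S/l` for large `l`, the powers of
`q` become small, and `bᵢ = (1/l) ∑_{j ≤ k} q ^ j + aᵢ q ^ (k + 1)` works for large `k`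
(`exists_mem_sum_mul_eq_one`). The bound on `S` holds because a maximal `T`-submodule containing `1`
but not `-1` is the nonnegative set of a point of `Sper A` (`exists_nonnegAt_iff_of_maximal`). -/

/-- A total subsemiring with prime support, as the set of nonnegative elements of a point of the
real spectrum. -/
theorem RealSpectrum.exists_nonnegAt_iff {A : Type*} [CommRing A] (P : Subsemiring A)
    (hP : ∀ a, a ∈ P ∨ -a ∈ P) (I : Ideal A) [hI : I.IsPrime]
    (hPI : ∀ a, a ∈ I ↔ a ∈ P ∧ -a ∈ P) :
    ∃ α : RealSpectrum A, ∀ a, α.NonnegAt a ↔ a ∈ P := by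
  classical
  let K := I.ResidueField
  let i : A →+* K := algebraMap A K
  have hi : ∀ a, i a = 0 ↔ a ∈ I := fun a => Ideal.algebraMap_residueField_eq_zero
  have mem_of_eq : ∀ a b, i a = i b → b ∈ P → a ∈ P := by
    intro a b h hb
    have : a - b ∈ I := by rw [← hi, map_sub, h, sub_self]
    simpa using P.add_mem ((hPI _).1 this).1 hb
  have cancel : ∀ a d, d ∈ P → d ∉ I → a * d ∈ P → a ∈ P := by
    intro a d hd hdI had
    by_contra ha
    have hna := (hP a).resolve_left ha
    have : a * d ∈ I := (hPI _).2 ⟨had, by simpa using P.mul_mem hna hd⟩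
    exact (hI.mem_or_mem this).elim (fun h => ha ((hPI _).1 h).1) hdI
  let C : RingCone K :=
    { carrier := {x | ∃ a ∈ P, ∃ d ∈ P, d ∉ I ∧ x * i d = i a}
      zero_mem' := ⟨0, P.zero_mem, 1, P.one_mem, I.ne_top_iff_one.1 hI.ne_top, by simp⟩
      one_mem' := ⟨1, P.one_mem, 1, P.one_mem, I.ne_top_iff_one.1 hI.ne_top, by simp⟩
      add_mem' := by
        rintro x y ⟨a, ha, d, hd, hdI, hx⟩ ⟨b, hb, e, he, heI, hy⟩
        refine ⟨a * e + b * d, P.add_mem (P.mul_mem ha he) (P.mul_mem hb hd), d * e,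
          P.mul_mem hd he, hI.mul_notMem hdI heI, ?_⟩
        simp only [map_add, map_mul, ← hx, ← hy]
        ring
      mul_mem' := by
        rintro x y ⟨a, ha, d, hd, hdI, hx⟩ ⟨b, hb, e, he, heI, hy⟩
        refine ⟨a * b, P.mul_mem ha hb, d * e, P.mul_mem hd he, hI.mul_notMem hdI heI, ?_⟩
        simp only [map_mul, ← hx, ← hy]
        ring
      eq_zero_of_mem_of_neg_mem' := by
        rintro x ⟨a, ha, d, hd, hdI, hx⟩ ⟨b, hb, e, he, heI, hy⟩
        have hab : -(a * e) ∈ P := by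
          refine mem_of_eq _ (b * d) ?_ (P.mul_mem hb hd)
          simp only [map_neg, map_mul, ← hx, ← hy]
          ring
        have hae : a * e ∈ I := (hPI _).2 ⟨P.mul_mem ha he, hab⟩
        have ha0 := (hi a).2 ((hI.mem_or_mem hae).resolve_right heI)
        rw [ha0] at hx
        exact (mul_eq_zero.1 hx).resolve_right fun h => hdI ((hi d).1 h) }
  have mem_C : ∀ a, i a ∈ C ↔ a ∈ P := by
    refine fun a => ⟨?_, fun ha =>
      ⟨a, ha, 1, P.one_mem, I.ne_top_iff_one.1 hI.ne_top, by simp⟩⟩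
    rintro ⟨b, hb, d, hd, hdI, h⟩
    exact cancel a d hd hdI (mem_of_eq _ b (by rw [map_mul, h]) hb)
  have total : HasMemOrNegMem C := by
    refine ⟨fun x => ?_⟩
    obtain ⟨a', d', hd', rfl⟩ := IsFractionRing.div_surjective (A := A ⧸ I) x
    obtain ⟨a, rfl⟩ := Ideal.Quotient.mk_surjective a'
    obtain ⟨d, rfl⟩ := Ideal.Quotient.mk_surjective d'
    have hd : d ∉ I := fun h =>
      nonZeroDivisors.ne_zero hd' (Ideal.Quotient.eq_zero_iff_mem.2 h)
    change i a / i d ∈ C ∨ -(i a / i d) ∈ C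
    have hid : i d ≠ 0 := fun h => hd ((hi d).1 h)
    have hdiv : i a / i d * i d = i a := div_mul_cancel₀ _ hid
    rcases hP d with h1 | h1 <;> rcases hP a with h2 | h2
    · exact .inl ⟨a, h2, d, h1, hd, hdiv⟩
    · exact .inr ⟨-a, h2, d, h1, hd, (neg_mul _ _).trans ((congrArg _ hdiv).trans (map_neg i a).symm)⟩
    · exact .inr ⟨a, h2, -d, h1, by simpa using hd, by
        rw [map_neg]; exact (neg_mul_neg _ _).trans hdiv⟩
    · exact .inl ⟨-a, h2, -d, h1, by simpa using hd, by
        rw [map_neg, map_neg]; exact (mul_neg _ _).trans (congrArg _ hdiv)⟩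
  let L : LinearOrder K := .mkOfAddGroupCone C
  have hL : IsOrderedRing K := .mkOfCone C
  refine ⟨⟨⟨I, hI⟩, L, hL.toIsStrictOrderedRing⟩, fun a => ?_⟩
  rw [← mem_C]
  change i a - 0 ∈ C ↔ _
  rw [sub_zero]

namespace Subsemiring

variable {A : Type*} [CommRing A] {T : Subsemiring A}

theorem IsArchimedean.exists_nat_add_mem (hT : T.IsArchimedean) (f : A) :
    ∃ k : ℕ, (k : A) + f ∈ T := by
  obtain ⟨n, hn⟩ := hT f
  refine ⟨n.toNat, ?_⟩
  have h : (n.toNat : A) + f = ((n.toNat - n).toNat : ℕ) + ((n : A) + f) := by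
    have : (((n.toNat - n).toNat : ℤ) : A) = ((n.toNat - n : ℤ) : A) := by
      rw [Int.toNat_of_nonneg (by have := Int.self_le_toNat n; omega)]
    rw [Int.cast_natCast] at this
    rw [this]
    push_cast
    ring
  rw [h]
  exact T.add_mem (natCast_mem T _) hn

theorem IsArchimedean.exists_nat_sub_mem (hT : T.IsArchimedean) (f : A) :
    ∃ k : ℕ, (k : A) - f ∈ T := by
  simpa [sub_eq_add_neg] using hT.exists_nat_add_mem (-f)

theorem natCast_sub_natCast_mem (T : Subsemiring A) {k l : ℕ} (h : k ≤ l) :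
    (l : A) - (k : A) ∈ T := by
  rw [← Nat.cast_sub h]
  exact natCast_mem T _

theorem exists_maximal_submodule_neg_one_notMem {M : Submodule T A} (hM : (-1 : A) ∉ M) :
    ∃ N, M ≤ N ∧ Maximal (fun N : Submodule T A => (-1 : A) ∉ N) N := by
  refine zorn_le_nonempty₀ {N : Submodule T A | (-1 : A) ∉ N} ?_ M hM
  intro c hc hchain y hy
  refine ⟨sSup c, ?_, fun z hz => le_sSup hz⟩
  intro h
  obtain ⟨N, hN, hN'⟩ := (Submodule.mem_sSup_of_directed ⟨y, hy⟩ hchain.directedOn).1 h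
  exact hc hN hN'

/-! ### Maximal `T`-submodules omitting `-1` -/

section Maximal

variable {M : Submodule T A}

theorem mul_mem_of_mem {t m : A} (ht : t ∈ T) (hm : m ∈ M) : t * m ∈ M :=
  M.smul_mem (⟨t, ht⟩ : T) hm

theorem mem_submodule_of_one_mem (h1 : (1 : A) ∈ M) {t : A} (ht : t ∈ T) : t ∈ M := by
  simpa using mul_mem_of_mem ht h1

theorem exists_mul_eq_of_notMem (hM : Maximal (fun N : Submodule T A => (-1 : A) ∉ N) M)
    {a : A} (ha : a ∉ M) : ∃ t ∈ T, ∃ m ∈ M, a * t = -1 - m := by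
  have h : (-1 : A) ∈ M ⊔ Submodule.span T {a} := by
    by_contra h
    exact ha (hM.2 h le_sup_left
      (le_sup_right (a := M) (Submodule.mem_span_singleton_self a)))
  obtain ⟨m, hm, y, hy, h⟩ := Submodule.mem_sup.1 h
  obtain ⟨t, rfl⟩ := Submodule.mem_span_singleton.1 hy
  refine ⟨t, t.2, m, hm, ?_⟩
  have h' : m + (t : A) * a = -1 := h
  linear_combination h'

theorem IsArchimedean.mul_mem_support (hT : T.IsArchimedean) (x : A) {a : A} (ha : a ∈ M)
    (hna : -a ∈ M) : x * a ∈ M := by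
  obtain ⟨k, hk⟩ := hT.exists_nat_add_mem x
  have h := M.add_mem (mul_mem_of_mem hk ha) (mul_mem_of_mem (natCast_mem T k) hna)
  convert h using 1
  ring

/-- Otherwise `a t = -1 - m` and `-a t' = -1 - m'`. Eliminating `a` gives `-t ∈ M`, so `t` lies in
the ideal `M ∩ -M`; then so does `a t`, and `-1 = a t + m ∈ M`. -/
theorem IsArchimedean.mem_or_neg_mem (hT : T.IsArchimedean) (h1 : (1 : A) ∈ M)
    (hM : Maximal (fun N : Submodule T A => (-1 : A) ∉ N) M) (a : A) : a ∈ M ∨ -a ∈ M := by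
  by_contra! h
  obtain ⟨t, ht, m, hm, e⟩ := exists_mul_eq_of_notMem hM h.1
  obtain ⟨t', ht', m', hm', e'⟩ := exists_mul_eq_of_notMem hM h.2
  have hneg : -t ∈ M := by
    have := M.add_mem (mem_submodule_of_one_mem h1 ht')
      (M.add_mem (mul_mem_of_mem ht' hm) (mul_mem_of_mem ht hm'))
    convert this using 1
    linear_combination (-t') * e - t * e'
  have hat := hT.mul_mem_support a (mem_submodule_of_one_mem h1 ht) hneg
  refine hM.1 ?_
  have := M.add_mem hat hm
  convert this using 1
  linear_combination -e

/-- The elements nonnegative up to an infinitesimal form a `T`-submodule that contains `M` and still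
omits `-1`, so it equals `M`. -/
theorem IsArchimedean.mem_of_forall_nat (hT : T.IsArchimedean) (h1 : (1 : A) ∈ M)
    (hM : Maximal (fun N : Submodule T A => (-1 : A) ∉ N) M) {a : A} (k : ℕ)
    (ha : ∀ q : ℕ, (q : A) * a + k ∈ M) : a ∈ M := by
  let N : Submodule T A :=
    { carrier := {a | ∃ k : ℕ, ∀ q : ℕ, (q : A) * a + k ∈ M}
      zero_mem' := ⟨0, fun q => by simp⟩
      add_mem' := by
        rintro a b ⟨k, hk⟩ ⟨l, hl⟩
        refine ⟨k + l, fun q => ?_⟩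
        convert M.add_mem (hk q) (hl q) using 1
        push_cast
        ring
      smul_mem' := by
        rintro ⟨t, ht⟩ a ⟨k, hk⟩
        obtain ⟨l, hl⟩ := hT.exists_nat_sub_mem ((k : A) * t)
        refine ⟨l, fun q => ?_⟩
        convert M.add_mem (mul_mem_of_mem ht (hk q)) (mem_submodule_of_one_mem h1 hl) using 1
        change (q : A) * (t * a) + l = _
        ring }
  have hN : (-1 : A) ∉ N := by
    rintro ⟨k, hk⟩
    refine hM.1 ?_
    convert hk (k + 1) using 1
    push_cast
    ring
  exact hM.2 hN (fun b hb => ⟨0, fun q => by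
    simpa using mul_mem_of_mem (natCast_mem T q) hb⟩) ⟨k, ha⟩

theorem IsArchimedean.exists_nat_floor (hT : T.IsArchimedean) (h1 : (1 : A) ∈ M)
    (hM : Maximal (fun N : Submodule T A => (-1 : A) ∉ N) M) {a : A} (ha : a ∈ M) :
    ∃ p : ℕ, a - p ∈ M ∧ (p : A) + 1 - a ∈ M := by
  classical
  have hex : ∃ k : ℕ, (k : A) + 1 - a ∈ M := by
    obtain ⟨k, hk⟩ := hT.exists_nat_sub_mem a
    refine ⟨k, mem_submodule_of_one_mem h1 ?_⟩
    convert T.add_mem hk T.one_mem using 1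
    ring
  refine ⟨Nat.find hex, ?_, Nat.find_spec hex⟩
  rcases h : Nat.find hex with _ | p
  · simpa using ha
  · have hp := Nat.find_min hex (m := p) (by omega)
    convert (hT.mem_or_neg_mem h1 hM _).resolve_left hp using 1
    push_cast
    ring

theorem IsArchimedean.mul_mem_of_maximal (hT : T.IsArchimedean) (h1 : (1 : A) ∈ M)
    (hM : Maximal (fun N : Submodule T A => (-1 : A) ∉ N) M) {a b : A} (ha : a ∈ M)
    (hb : b ∈ M) : a * b ∈ M := by
  obtain ⟨k, hk⟩ := hT.exists_nat_add_mem b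
  refine hT.mem_of_forall_nat h1 hM k fun q => ?_
  -- As `M` is only stable under `T`, `q a` is compared with its integer part `p`: `q a b + k = (k +
  -- b)(q a - p) + p b + k (p + 1 - q a)`.
  obtain ⟨p, hp, hp'⟩ :=
    hT.exists_nat_floor h1 hM (mul_mem_of_mem (natCast_mem T q) ha)
  have := M.add_mem (mul_mem_of_mem hk hp) (M.add_mem (mul_mem_of_mem (natCast_mem T p) hb)
    (mul_mem_of_mem (natCast_mem T k) hp'))
  convert this using 1
  ring

theorem IsArchimedean.exists_nonnegAt_iff_of_maximal (hT : T.IsArchimedean) (h1 : (1 : A) ∈ M)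
    (hM : Maximal (fun N : Submodule T A => (-1 : A) ∉ N) M) :
    ∃ α : RealSpectrum A, ∀ a, α.NonnegAt a ↔ a ∈ M := by
  let P : Subsemiring A :=
    { carrier := M
      zero_mem' := M.zero_mem
      one_mem' := h1
      add_mem' := M.add_mem
      mul_mem' := hT.mul_mem_of_maximal h1 hM }
  let I : Ideal A :=
    { carrier := {a | a ∈ M ∧ -a ∈ M}
      zero_mem' := ⟨M.zero_mem, by simp⟩
      add_mem' := fun {a b} ha hb =>
        ⟨M.add_mem ha.1 hb.1, by rw [neg_add]; exact M.add_mem ha.2 hb.2⟩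
      smul_mem' := fun x a ha => ⟨hT.mul_mem_support x ha.1 ha.2, by
        rw [smul_eq_mul, ← mul_neg]
        exact hT.mul_mem_support x ha.2 (by simpa using ha.1)⟩ }
  have hpos : ∀ a b, -a ∉ M → -b ∉ M → -(a * b) ∉ M := by
    intro a b ha hb hab
    obtain ⟨t, ht, m, hm, e⟩ := exists_mul_eq_of_notMem hM ha
    have hb' := (hT.mem_or_neg_mem h1 hM b).resolve_right hb
    refine hb ?_
    convert M.add_mem (mul_mem_of_mem ht hab) (hT.mul_mem_of_maximal h1 hM hm hb') using 1
    linear_combination (-b) * e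
  have hI : I.IsPrime := by
    refine ⟨fun h => hM.1 ((I.eq_top_iff_one.1 h).2), fun {a b} hab => ?_⟩
    by_contra! h
    have key : ∀ x, x ∉ I → ∃ y, -y ∉ M ∧ (y = x ∨ y = -x) := by
      intro x hx
      by_cases hx' : -x ∈ M
      · exact ⟨-x, fun h => hx ⟨by simpa using h, hx'⟩, .inr rfl⟩
      · exact ⟨x, hx', .inl rfl⟩
    obtain ⟨y, hy, hya⟩ := key a h.1
    obtain ⟨z, hz, hzb⟩ := key b h.2
    refine hpos y z hy hz ?_
    rcases hya with rfl | rfl <;> rcases hzb with rfl | rfl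
    · exact hab.2
    · simpa using hab.1
    · simpa using hab.1
    · simpa using hab.2
  exact RealSpectrum.exists_nonnegAt_iff P (hT.mem_or_neg_mem h1 hM) I fun a => Iff.rfl

end Maximal

/-! ### Representation theorem -/

/-- An element `s` which is not `≤ 0` at any point of `X_A(T)` satisfies an identity
`s t = 1 + t'` with `t, t' ∈ T`. -/
theorem IsArchimedean.exists_mul_eq_one_add (hT : T.IsArchimedean) {s : A}
    (hs : ∀ α ∈ RealSpectrum.nonnegLocus T, ¬ α.NonnegAt (-s)) :
    ∃ t ∈ T, ∃ t' ∈ T, s * t = 1 + t' := by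
  let N : Submodule T A := Submodule.span T {1, -s}
  by_cases hN : (-1 : A) ∈ N
  · obtain ⟨⟨a, ha⟩, ⟨b, hb⟩, h⟩ := Submodule.mem_span_pair.1 hN
    have h' : a * 1 + b * (-s) = -1 := h
    exact ⟨b, hb, a, ha, by linear_combination -h'⟩
  · obtain ⟨M, hNM, hM⟩ := exists_maximal_submodule_neg_one_notMem hN
    have h1 : (1 : A) ∈ M := hNM (Submodule.subset_span (by simp))
    obtain ⟨α, hα⟩ := hT.exists_nonnegAt_iff_of_maximal h1 hM
    exact (hs α (fun t ht => (hα t).2 (mem_submodule_of_one_mem h1 ht))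
      ((hα _).2 (hNM (Submodule.subset_span (by simp))))).elim

theorem exists_inv_natCast_mem_of_le {n : ℕ} (hn : 1 < n) {u : A} (hu : u ∈ T)
    (hnu : (n : A) * u = 1) (k : ℕ) : ∃ m : ℕ, k ≤ m ∧ ∃ v ∈ T, (m : A) * v = 1 :=
  ⟨n ^ k, (Nat.lt_pow_self hn).le, u ^ k, T.pow_mem hu k, by
    rw [Nat.cast_pow, ← mul_pow, hnu, one_pow]⟩

/-- The representation theorem for archimedean semirings: an element that is positive on `X_A(T)`
is bounded below in `T` by the inverse of a positive integer. -/
theorem IsArchimedean.exists_sub_inv_mem (hT : T.IsArchimedean)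
    (hn : ∃ n : ℕ, 1 < n ∧ ∃ u ∈ T, (n : A) * u = 1) {s : A}
    (hs : ∀ α ∈ RealSpectrum.nonnegLocus T, ¬ α.NonnegAt (-s)) :
    ∃ m : ℕ, 0 < m ∧ ∃ v ∈ T, (m : A) * v = 1 ∧ s - v ∈ T := by
  obtain ⟨n, hn, u, hu, hnu⟩ := hn
  obtain ⟨t, ht, t', ht', e⟩ := hT.exists_mul_eq_one_add hs
  obtain ⟨k, hk⟩ := hT.exists_nat_sub_mem t
  obtain ⟨m, hkm, v, hv, hmv⟩ := exists_inv_natCast_mem_of_le hn hu hnu (k + 1)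
  have hmt : (m : A) - t ∈ T := by
    convert T.add_mem (natCast_sub_natCast_mem T (Nat.le_of_succ_le hkm)) hk using 1
    ring
  refine ⟨m, Nat.zero_lt_of_lt hkm, v, hv, hmv, ?_⟩
  -- Since `s t = 1 + t'`, multiplying `s + j v` by `1 - v t ∈ T` lowers it by `v`, up to terms in
  -- `T`.
  have step : ∀ j : ℕ, s + j * v ∈ T → s + j * v - v ∈ T := by
    intro j hj
    convert T.mul_mem hv (T.add_mem (T.mul_mem hmt hj) (T.add_mem ht'
      (T.mul_mem (T.mul_mem (natCast_mem T j) hv) ht))) using 1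
    linear_combination (-(s + j * v)) * hmv + v * e
  have descend : ∀ j : ℕ, s + j * v ∈ T → s - v ∈ T := by
    intro j
    induction j with
    | zero => intro h; simpa using step 0 h
    | succ j ih =>
      intro h
      refine ih ?_
      convert step _ h using 1
      push_cast
      ring
  obtain ⟨l, hl⟩ := hT.exists_nat_add_mem s
  refine descend (l * m) ?_
  convert hl using 1
  push_cast
  linear_combination (l : A) * hmv

theorem sub_pow_mem {a b : A} (ha : a ∈ T) (hb : b ∈ T) (hab : a - b ∈ T) (k : ℕ) :
    a ^ k - b ^ k ∈ T := by
  rw [← geom_sum₂_mul]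
  exact T.mul_mem (T.sum_mem fun i _ => T.mul_mem (T.pow_mem ha _) (T.pow_mem hb _)) hab

theorem exists_mul_pow_le_succ_pow (c r : ℕ) : ∃ k : ℕ, c * r ^ (k + 1) ≤ (r + 1) ^ (k + 1) := by
  have hr : (0 : ℝ) < (r : ℝ) + 1 := by positivity
  obtain ⟨k, hk⟩ := exists_pow_lt_of_lt_one (x := 1 / ((c : ℝ) + 1)) (y := r / ((r : ℝ) + 1))
    (by positivity) (by rw [div_lt_one hr]; linarith)
  refine ⟨k, ?_⟩
  suffices h : c * r ^ k ≤ (r + 1) ^ k by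
    rw [pow_succ, pow_succ, ← mul_assoc]
    exact Nat.mul_le_mul h r.le_succ
  rw [div_pow, div_lt_div_iff₀ (by positivity) (by positivity)] at hk
  have h : (c : ℝ) * (r : ℝ) ^ k ≤ ((r : ℝ) + 1) ^ k := by
    have : (0 : ℝ) ≤ (r : ℝ) ^ k := by positivity
    nlinarith
  exact_mod_cast h

/-! ### Coefficients in `T` and the conclusion -/

/-- If `∑ a i * s i = 1`, and the sum of the `s i` is positive on `X_A(T)`, then the coefficients
`a i` can be replaced by elements of `T`. -/
theorem IsArchimedean.exists_mem_sum_mul_eq_one (hT : T.IsArchimedean)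
    (hn : ∃ n : ℕ, 1 < n ∧ ∃ u ∈ T, (n : A) * u = 1) {ι : Type*} (F : Finset ι) (a s : ι → A)
    (has : ∑ i ∈ F, a i * s i = 1)
    (hs : ∀ α ∈ RealSpectrum.nonnegLocus T, ¬ α.NonnegAt (-∑ i ∈ F, s i)) :
    ∃ b : ι → A, (∀ i ∈ F, b i ∈ T) ∧ ∑ i ∈ F, b i * s i = 1 := by
  obtain ⟨m, hm, v, hv, hmv, hsv⟩ := hT.exists_sub_inv_mem hn hs
  obtain ⟨n, hn, u, hu, hnu⟩ := hn
  set S := ∑ i ∈ F, s i with hS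
  obtain ⟨k₀, hk₀⟩ := hT.exists_nat_sub_mem S
  obtain ⟨l, hkl, w, hw, hlw⟩ := exists_inv_natCast_mem_of_le hn hu hnu (k₀ + 1)
  have hlS : (l : A) - S ∈ T := by
    convert T.add_mem (natCast_sub_natCast_mem T (Nat.le_of_succ_le hkl)) hk₀ using 1
    ring
  choose c hc using fun i => hT.exists_nat_add_mem (a i)
  have hC : ∀ i ∈ F, ((∑ j ∈ F, c j : ℕ) : A) + a i ∈ T := by
    intro i hi
    convert T.add_mem (natCast_sub_natCast_mem T
      (Finset.single_le_sum (f := c) (fun _ _ => Nat.zero_le _) hi)) (hc i) using 1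
    ring
  set L := ∑ j ∈ F, c j
  obtain ⟨r, hr⟩ := Nat.exists_eq_add_one_of_ne_zero
    (Nat.mul_pos (Nat.zero_lt_of_lt hkl) hm).ne'
  have hx : ((r : A) + 1) * (w * v) = 1 := by
    have : (l : A) * m = r + 1 := by exact_mod_cast congrArg (Nat.cast (R := A)) hr
    rw [← this]
    linear_combination (l * w) * hmv + hlw
  -- Here `r + 1 = l m`, so `0 ≤ q ≤ ρ = 1 - 1/(l m)` modulo `T`; `k` is chosen so that `L ρ ^ (k +
  -- 1) ≤ 1/l = w`, where `-L` bounds every `a i` from below.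
  obtain ⟨k, hk⟩ := exists_mul_pow_le_succ_pow (L * l) r
  set q : A := 1 - w * S with hq
  set ρ : A := r * (w * v) with hρ
  have hρT : ρ ∈ T := T.mul_mem (natCast_mem T r) (T.mul_mem hw hv)
  have hqT : q ∈ T := by
    convert T.mul_mem hw hlS using 1
    linear_combination -hlw
  have hρq : ρ - q ∈ T := by
    convert T.mul_mem hw hsv using 1
    linear_combination hx
  have hwL : w - L * ρ ^ (k + 1) ∈ T := by
    convert T.mul_mem (T.mul_mem hw (T.pow_mem (T.mul_mem hw hv) (k + 1)))
      (natCast_sub_natCast_mem T hk) using 1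
    have hx' := congrArg (· ^ (k + 1)) hx
    simp only [mul_pow, one_pow] at hx'
    push_cast
    rw [hρ, mul_pow, mul_pow]
    linear_combination (-w) * hx' + (L * r ^ (k + 1) * w ^ (k + 1) * v ^ (k + 1)) * hlw
  refine ⟨fun i => w * (∑ j ∈ Finset.range (k + 1), q ^ j) + a i * q ^ (k + 1), fun i hi => ?_, ?_⟩
  · rw [Finset.sum_range_succ']
    convert T.add_mem (T.mul_mem hw (T.sum_mem fun j (_ : j ∈ Finset.range k) =>
      T.pow_mem hqT (j + 1))) (T.add_mem (T.mul_mem (hC i hi) (T.pow_mem hqT (k + 1)))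
      (T.add_mem hwL (T.mul_mem (natCast_mem T L) (sub_pow_mem hρT hqT hρq (k + 1))))) using 1
    ring
  · have hgeom := mul_neg_geom_sum q (k + 1)
    calc _ = (w * ∑ j ∈ Finset.range (k + 1), q ^ j) * S
          + q ^ (k + 1) * ∑ i ∈ F, a i * s i := by
          generalize ∑ j ∈ Finset.range (k + 1), q ^ j = g
          rw [hS, Finset.mul_sum, Finset.mul_sum, ← Finset.sum_add_distrib]
          exact Finset.sum_congr rfl fun i _ => by ring
      _ = 1 := by
          rw [has]
          linear_combination hgeom + (∑ j ∈ Finset.range (k + 1), q ^ j) * hq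

end Subsemiring

theorem RealSpectrum.NonnegAt.not_neg_sum {A : Type*} [CommRing A] {α : RealSpectrum A}
    {ι : Type*} (F : Finset ι) (a s : ι → A) (has : ∑ i ∈ F, a i * s i = 1)
    (hs : ∀ i ∈ F, α.NonnegAt (s i)) : ¬ α.NonnegAt (-∑ i ∈ F, s i) := by
  intro h
  let K := α.support.asIdeal.ResidueField
  let i : A →+* K := algebraMap A K
  let _ : LinearOrder K := α.order
  have _ : IsStrictOrderedRing K := α.isStrictOrderedRing
  have hs' : ∀ j ∈ F, 0 ≤ i (s j) := hs
  have h' : 0 ≤ i (-∑ j ∈ F, s j) := h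
  rw [map_neg, map_sum, neg_nonneg] at h'
  have h0 := (Finset.sum_eq_zero_iff_of_nonneg hs').1 (h'.antisymm (Finset.sum_nonneg hs'))
  have h1 : i 1 = 0 := by
    rw [← has, map_sum]
    exact Finset.sum_eq_zero fun j hj => by rw [map_mul, h0 j hj, mul_zero]
  rw [map_one] at h1
  exact one_ne_zero h1

theorem theorem4p2 {A : Type*} [CommRing A] (T : Subsemiring A) (hT : T.IsArchimedean)
    (hn : ∃ n : ℕ, 1 < n ∧ ∃ u ∈ T, (n : A) * u = 1) (f : A)
    (hf : ∀ m : Ideal A, m.IsMaximal →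
      ∃ s : A, s ∉ m ∧ (∀ α ∈ RealSpectrum.nonnegLocus T, α.NonnegAt s) ∧ s * f ∈ T) :
    f ∈ T := by
  set Z : Set A := {s | (∀ α ∈ RealSpectrum.nonnegLocus T, α.NonnegAt s) ∧ s * f ∈ T}
  have htop : Ideal.span Z = ⊤ := by
    by_contra h
    obtain ⟨m, hm, hle⟩ := Ideal.exists_le_maximal _ h
    obtain ⟨s, hsm, hs⟩ := hf m hm
    exact hsm (hle (Ideal.subset_span hs))
  have h1 : (1 : A) ∈ Submodule.span A Z := (Ideal.eq_top_iff_one _).1 htop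
  obtain ⟨a, F, hFZ, -, ha⟩ := Submodule.mem_span_iff_exists_finset_subset.1 h1
  have ha' : ∑ s ∈ F, a s * id s = 1 := ha
  obtain ⟨b, hb, hb1⟩ := hT.exists_mem_sum_mul_eq_one hn F a id ha' fun α hα =>
    RealSpectrum.NonnegAt.not_neg_sum F a id ha' fun s hs => (hFZ hs).1 α hα
  rw [← one_mul f, ← hb1, Finset.sum_mul]
  refine T.sum_mem fun s hs => ?_
  rw [mul_assoc]
  exact T.mul_mem (hb s hs) (hFZ hs).2
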